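/- **Setting.** Let $S$ be a complete separable metric space with metric $d$, on which a second countable, locally compact Hausdorff, unimodular group $G$ acts continuously, transitively, by isometries and with compact stabilizers. Let $|\cdot|$ be a non-zero locally finite $G$-invariant Borel measure on $S$. (Example: $S=\mathbb R^d$ with translations and Lebesgue measure, or a sphere with rotations and the spherical measure.) A point pattern is a subset of $S$ with finitely many points in every bounded set. For a point pattern $\mathbf x$, the Voronoi cell of $x\in\mathbf x$ is $$\mathcal V_x(\mathbf x)=\{u\in S: d(x,u)\le d(y,u)\ \text{for all } y\in\mathbf x\setminus\{x\}\},$$ and the Voronoi intensity estimator is $$\widehat\rho^{V}(u;\mathbf x)=\sum_{x\in\mathbf x}\frac{\mathbf 1\{u\in\mathcal V_x(\mathbf x)\}}{|\mathcal V_x(\mathbf x)|},\qquad u\in S,$$ where, if $u$ lies in several cells, only one of these cells, chosen by an arbitrary fixed rule, is counted (and $1/\infty=0$). Let $X$ be a simple point process on $S$ (a random point pattern) which is stationary, i.e. $gX=\{gx:x\in X\}$ has the same distribution as $X$ for every $g\in G$, and has constant intensity $\rho\in(0,\infty)$, i.e. $\mathbb E\sum_{x\in X}f(x)=\rho\int_S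 f(u)\,\mathrm du$ for every measurable $f\ge 0$. Let $p\in(0,1]$ and $m\ge1$, and let $X_p^1,\dots,X_p^m$ be independent $p$-thinnings of $X$: in each of them every point of $X$ is retained with probability $p$, all retention decisions being independent of each other and of $X$. Assume that for each $i$ the Voronoi cells of $X_p^i$ almost surely tessellate $S$ up to null sets, in the sense that any two distinct cells overlap in a set of measure $0$ (this holds, for instance, if $|\{u: d(x,u)=d(y,u)\}|=0$ for all $x\ne y$). The resample-smoothed Voronoi intensity estimator is $$\widehat\rho_{p,m}^{V}(u)=\frac1m\sum_{i=1}^m\frac{\widehat\rho^{V}(u;X_p^i)}{p}.$$ **Theorem.** Under these assumptions the estimator is unbiased: for every $u\in S$, $\widehat\rho_{p,m}^{V}(u)$ is integrable and $$\mathbb E\big[\widehat\rho_{p,m}^{V}(u)\big]=\rho .$$ -/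

import Mathlib

open MeasureTheory ProbabilityTheory
open scoped ENNReal NNReal

noncomputable section

/-- A (simple) point pattern in a metric space `S`: a set of points which is locally finite, i.e.
has only finitely many points in each bounded set. -/
@[ext]
structure PointPattern (S : Type*) [MetricSpace S] where
  /-- the points of the pattern -/
  points : Set S
  finite_inter : ∀ B : Set S, Bornology.IsBounded B → (points ∩ B).Finite

namespace PointPattern

variable {S : Type*} [MetricSpace S]

/-- The σ-algebra on the space of point patterns, generated by the point counts
`η ↦ N(η ∩ A)` for Borel sets `A`. -/
instance instMeasurableSpace [MeasurableSpace S] : MeasurableSpace (PointPattern S) :=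
  ⨆ A : {A : Set S // MeasurableSet A},
    MeasurableSpace.comap (fun η : PointPattern S => (η.points ∩ A.1).encard) inferInstance

/-- The image `θ_g η = {g • x : x ∈ η}` of a point pattern under an isometric group action. -/
def shift {G : Type*} [Group G] [MulAction G S] [IsIsometricSMul G S] (g : G)
    (η : PointPattern S) : PointPattern S where
  points := (fun x : S => g • x) '' η.points
  finite_inter := by
    intro B hB
    have h1 : Bornology.IsBounded ((fun x : S => g⁻¹ • x) '' B) :=
      (isometry_smul S g⁻¹).lipschitz.isBounded_image hB
    refine ((η.finite_inter _ h1).image (fun x : S => g • x)).subset ?_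
    rintro _ ⟨⟨x, hx, rfl⟩, hB'⟩
    exact ⟨x, ⟨hx, ⟨_, hB', by simp⟩⟩, rfl⟩

end PointPattern

section PointProcess

variable {Ω S : Type*} [MeasurableSpace Ω] [MetricSpace S] [MeasurableSpace S]

/-- A simple point process: a random point pattern. -/
def IsPointProcess (X : Ω → PointPattern S) : Prop :=
  Measurable X

/-- Stationarity under the action of `G` on `S`: `θ_g X` and `X` have the same distribution,
for every `g`. -/
def IsStationaryProcess (G : Type*) [Group G] [MulAction G S] [IsIsometricSMul G S]
    (P : Measure Ω) (X : Ω → PointPattern S) : Prop :=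
  ∀ g : G, IdentDistrib (fun ω => (X ω).shift g) X P P

/-- `ρ` is an intensity function of `X` with respect to the reference measure `μ`
(Campbell formula). -/
def HasIntensity (P : Measure Ω) (μ : Measure S) (X : Ω → PointPattern S) (ρ : S → ℝ≥0) : Prop :=
  Measurable ρ ∧ ∀ f : S → ℝ≥0∞, Measurable f →
    ∫⁻ ω, ∑' x : (X ω).points, f x ∂P = ∫⁻ u, f u * ρ u ∂μ

/-- `Y 0, …, Y (m - 1)` are `m` independent `p`-thinnings of `X`: run through the points
`ξ 0, ξ 1, …` of `X` (there are `N ≤ ∞` of them, listed without repetition) and, for the `i`-th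
thinning, retain the point `ξ n` if and only if the mark `B (i, n)` is `true`. The marks are
i.i.d. with `P (B (i, n) = true) = p`, and independent of the points. -/
def IsThinning (P : Measure Ω) (X : Ω → PointPattern S) (p : ℝ) {m : ℕ}
    (Y : Fin m → Ω → PointPattern S) : Prop :=
  ∃ (N : Ω → ℕ∞) (ξ : ℕ → Ω → S) (B : Fin m × ℕ → Ω → Bool),
    Measurable N ∧ (∀ n, Measurable (ξ n)) ∧ (∀ k, Measurable (B k)) ∧
    (∀ᵐ ω ∂P, Set.InjOn (fun n => ξ n ω) {n : ℕ | (n : ℕ∞) < N ω} ∧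
      (X ω).points = (fun n => ξ n ω) '' {n : ℕ | (n : ℕ∞) < N ω}) ∧
    (∀ k, P {ω | B k ω = true} = ENNReal.ofReal p) ∧
    iIndepFun B P ∧
    IndepFun (fun ω => (N ω, fun n => ξ n ω)) (fun ω k => B k ω) P ∧
    ∀ i, ∀ᵐ ω ∂P,
      (Y i ω).points = (fun n => ξ n ω) '' {n : ℕ | (n : ℕ∞) < N ω ∧ B (i, n) ω = true}

end PointProcess

section Voronoi

variable {S : Type*} [MetricSpace S]

/-- The Voronoi cell `𝒱_x(η, W)`. -/
def voronoiCell (W : Set S) (η : PointPattern S) (x : S) : Set S :=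
  {u | u ∈ W ∧ ∀ y ∈ η.points \ {x}, dist x u ≤ dist y u}

/-- A tie-breaking rule: to a pattern `η` and a location `u` which is covered by at least one
Voronoi cell, it assigns the nucleus of one of the cells covering `u`. -/
def IsTieRule (W : Set S) (τ : PointPattern S → S → S) : Prop :=
  ∀ (η : PointPattern S) (u : S), (∃ x ∈ η.points ∩ W, u ∈ voronoiCell W η x) →
    τ η u ∈ η.points ∩ W ∧ u ∈ voronoiCell W η (τ η u)

variable [MeasurableSpace S]

open Classical in
/-- The Voronoi intensity estimator
`∑_{x ∈ η ∩ W} 1{u ∈ 𝒱_x} / |𝒱_x|`, where, if several cells cover `u`, only the one chosen by the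
rule `τ` is counted. -/
def voronoiEstimator (μ : Measure S) (W : Set S) (τ : PointPattern S → S → S)
    (η : PointPattern S) (u : S) : ℝ :=
  ∑' x : ↥(η.points ∩ W),
    if u ∈ voronoiCell W η x ∧ τ η u = x then ((μ (voronoiCell W η x))⁻¹).toReal else 0

/-- The resample-smoothed Voronoi intensity estimator, computed from the thinned patterns
`ζ 0, …, ζ (m - 1)` with retention probability `p`. -/
def resampleSmoothedVoronoi (μ : Measure S) (W : Set S) (τ : PointPattern S → S → S)
    (p : ℝ) {m : ℕ} (ζ : Fin m → PointPattern S) (u : S) : ℝ :=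
  1 / (m : ℝ) * ∑ i, voronoiEstimator μ W τ (ζ i) u / p

/-- Distinct Voronoi cells of `η` overlap in a `μ`-null set only. -/
def VoronoiNullOverlap (μ : Measure S) (W : Set S) (η : PointPattern S) : Prop :=
  ∀ x ∈ η.points ∩ W, ∀ y ∈ η.points ∩ W, x ≠ y →
    μ (voronoiCell W η x ∩ voronoiCell W η y) = 0

end Voronoi

/-- A topological group is unimodular if its (left) Haar measures are also right invariant. -/
def IsUnimodularGroup (G : Type*) [Group G] [TopologicalSpace G] [MeasurableSpace G] : Prop :=
  ∀ ν : Measure G, ν.IsHaarMeasure → ν.IsMulRightInvariant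

end

set_option linter.unusedSectionVars false

/-! Let every point `x` of a stationary pattern spread unit mass uniformly over its Voronoi cell, so
that the mass density arriving at `u` is the Voronoi estimator at `u`. The mass transport principle
says that a ball `A` sends out as much expected mass as it receives. If the intensity is `c`, it
sends `c * μ A`; it receives the integral over `A` of the expected estimator, which is constant by
stationarity and transitivity. Hence this expectation is `c` (`lintegral_voronoiWeightSum`).

The principle itself (`mass_transport_ball`, `lintegral_mass_transport`) comes from averaging a
diagonally invariant measure on `S × S` over the unimodular group. Each point sends mass exactly 1
only if its cell has positive finite measure. Positivity holds because a cell contains a ball;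
finiteness follows from a second transport, with the cell indicator as its density, since almost
surely at most one cell covers a given location (`ae_voronoiCoverage_le_one`).

For a thinning, void probabilities are expectations of `(1 - p) ^ N(A)`, with `N(A)` the count of
the original process. They determine the law, so stationarity passes to the thinning, whose
intensity is `p * ρ`. Dividing by `p` and averaging over the thinnings gives `ρ`. -/

/-- Finitely many points have disjoint neighbourhoods, which shrink to basic open sets. Counts are
thereby expressed through countably many hitting events. -/
theorem natCast_le_encard_iff_exists_disjoint_basis {S : Type*} [TopologicalSpace S] [T2Space S]
    [SecondCountableTopology S] (s : Set S) (k : ℕ) :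
    (k : ℕ∞) ≤ s.encard ↔ ∃ c : Fin k → TopologicalSpace.countableBasis S,
      Pairwise (fun i j => Disjoint (c i : Set S) (c j)) ∧ ∀ i, (s ∩ c i).Nonempty := by
  constructor
  · intro h
    obtain ⟨t, hts, htk⟩ := Set.exists_subset_encard_eq h
    have htf : t.Finite := Set.finite_of_encard_eq_coe htk
    obtain ⟨U, hU, hdis⟩ := htf.t2_separation
    have hcard : t.ncard = k := by
      rw [Set.ncard, htk]; simp
    have : Finite t := htf
    obtain ⟨e⟩ : Nonempty (Fin k ≃ t) := ⟨(Finite.equivFinOfCardEq hcard).symm⟩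
    have hb : ∀ i, ∃ v ∈ TopologicalSpace.countableBasis S, (e i : S) ∈ v ∧ v ⊆ U (e i) := fun i =>
      (TopologicalSpace.isBasis_countableBasis S).exists_subset_of_mem_open (hU _).1 (hU _).2
    choose v hv hev hvU using hb
    refine ⟨fun i => ⟨v i, hv i⟩, fun i j hij => ?_, fun i => ⟨e i, hts (e i).2, hev i⟩⟩
    exact (hdis (e i).2 (e j).2 fun h => hij (e.injective (Subtype.ext h))).mono (hvU i) (hvU j)
  · rintro ⟨c, hc, hs⟩
    choose x hx using hs
    have hinj : Function.Injective x := fun i j hij => by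
      by_contra hne
      exact Set.disjoint_left.1 (hc hne) (hx i).2 (hij ▸ (hx j).2)
    calc (k : ℕ∞) = (Set.range x).encard := by
          rw [← Set.image_univ, hinj.encard_image, Set.encard_univ]; simp
      _ ≤ s.encard := Set.encard_le_encard (Set.range_subset_iff.2 fun i => (hx i).1)

/-! ### Point patterns: void events and the counting kernel -/

namespace PointPattern

variable {S : Type*} [MetricSpace S]

theorem countable_points (η : PointPattern S) : η.points.Countable := by
  rcases η.points.eq_empty_or_nonempty with h | ⟨x, -⟩
  · simp [h]
  have : η.points = ⋃ n : ℕ, η.points ∩ Metric.ball x n := by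
    rw [← Set.inter_iUnion, Metric.iUnion_ball_nat, Set.inter_univ]
  rw [this]
  exact Set.countable_iUnion fun n => (η.finite_inter _ Metric.isBounded_ball).countable

section Shift

variable {G : Type*} [Group G] [MulAction G S] [IsIsometricSMul G S]

theorem shift_points_inter_eq_empty (g : G) (η : PointPattern S) (A : Set S) :
    (η.shift g).points ∩ A = ∅ ↔ η.points ∩ (fun x : S => g • x) ⁻¹' A = ∅ := by
  simp only [Set.eq_empty_iff_forall_notMem, shift, Set.mem_inter_iff, Set.mem_image,
    Set.mem_preimage]
  constructor
  · exact fun h x hx => h _ ⟨⟨x, hx.1, rfl⟩, hx.2⟩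
  · rintro h _ ⟨⟨x, hx, rfl⟩, hA⟩
    exact h x ⟨hx, hA⟩

theorem encard_shift_points_inter (g : G) (η : PointPattern S) (A : Set S) :
    ((η.shift g).points ∩ A).encard = (η.points ∩ (fun x : S => g • x) ⁻¹' A).encard := by
  rw [← (MulAction.injective g).encard_image (η.points ∩ (fun x : S => g • x) ⁻¹' A),
    Set.image_inter_preimage]
  rfl

end Shift

variable [MeasurableSpace S]

theorem measurable_encard_inter {A : Set S} (hA : MeasurableSet A) :
    Measurable fun η : PointPattern S => (η.points ∩ A).encard :=
  Measurable.of_comap_le (le_iSup (fun A : {A : Set S // MeasurableSet A} =>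
    MeasurableSpace.comap (fun η : PointPattern S => (η.points ∩ A.1).encard) inferInstance)
      ⟨A, hA⟩)

theorem measurableSet_inter_eq_empty {A : Set S} (hA : MeasurableSet A) :
    MeasurableSet {η : PointPattern S | η.points ∩ A = ∅} := by
  have := measurable_encard_inter hA (measurableSet_singleton 0)
  simpa [Set.preimage, Set.encard_eq_zero] using this

/-- The events that a bounded Borel set contains no point of the pattern. -/
def boundedVoidEvents (S : Type*) [MetricSpace S] [MeasurableSpace S] :
    Set (Set (PointPattern S)) :=
  {s | ∃ A : Set S, MeasurableSet A ∧ Bornology.IsBounded A ∧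
    s = {η : PointPattern S | η.points ∩ A = ∅}}

theorem isPiSystem_boundedVoidEvents : IsPiSystem (boundedVoidEvents S) := by
  rintro _ ⟨A, hA, hbA, rfl⟩ _ ⟨B, hB, hbB, rfl⟩ -
  refine ⟨A ∪ B, hA.union hB, hbA.union hbB, ?_⟩
  ext η
  simp [Set.inter_union_distrib_left]

variable [BorelSpace S] [SecondCountableTopology S]

/-- A version of Rényi's theorem: void events generate the σ-algebra of simple point patterns. -/
theorem instMeasurableSpace_eq_generateFrom :
    (instMeasurableSpace : MeasurableSpace (PointPattern S)) =
      MeasurableSpace.generateFrom (boundedVoidEvents S) := by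
  apply le_antisymm
  · have hvoid : ∀ A : Set S, MeasurableSet A → MeasurableSet[MeasurableSpace.generateFrom
        (boundedVoidEvents S)] {η : PointPattern S | η.points ∩ A = ∅} := by
      intro A hA
      rcases isEmpty_or_nonempty S with hS | ⟨⟨o⟩⟩
      · convert! MeasurableSet.univ
        ext η
        simp [Set.eq_empty_of_isEmpty]
      -- The generators only involve bounded sets, so `A` is exhausted by its intersections with
      -- balls.
      have : {η : PointPattern S | η.points ∩ A = ∅} =
          ⋂ n : ℕ, {η : PointPattern S | η.points ∩ (A ∩ Metric.ball o n) = ∅} := by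
        ext η
        simp only [Set.mem_ofPred_eq, Set.mem_iInter]
        rw [← Set.iUnion_eq_empty, ← Set.inter_iUnion, ← Set.inter_iUnion, Metric.iUnion_ball_nat,
          Set.inter_univ]
      rw [this]
      exact MeasurableSet.iInter fun n => MeasurableSpace.measurableSet_generateFrom
        ⟨_, hA.inter measurableSet_ball, Metric.isBounded_ball.subset Set.inter_subset_right, rfl⟩
    refine iSup_le fun ⟨A, hA⟩ => ?_
    have hle : ∀ k : ℕ, MeasurableSet[MeasurableSpace.generateFrom (boundedVoidEvents S)]
        {η : PointPattern S | (k : ℕ∞) ≤ (η.points ∩ A).encard} := by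
      intro k
      simp_rw [natCast_le_encard_iff_exists_disjoint_basis]
      have : {η : PointPattern S | ∃ c : Fin k → TopologicalSpace.countableBasis S,
          Pairwise (fun i j => Disjoint (c i : Set S) (c j)) ∧
          ∀ i, (η.points ∩ A ∩ c i).Nonempty} =
          ⋃ c ∈ {c : Fin k → TopologicalSpace.countableBasis S |
            Pairwise (fun i j => Disjoint (c i : Set S) (c j))},
            ⋂ i, {η : PointPattern S | η.points ∩ (A ∩ c i) = ∅}ᶜ := by
        ext η
        simp [Set.nonempty_iff_ne_empty, Set.inter_assoc]
      rw [this]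
      refine MeasurableSet.biUnion (Set.to_countable _) fun c _ => MeasurableSet.iInter fun i => ?_
      exact (hvoid _ (hA.inter
        (TopologicalSpace.isOpen_of_mem_countableBasis (c i).2).measurableSet)).compl
    rw [← measurable_iff_comap_le]
    refine @measurable_to_countable' _ _ _ _ (MeasurableSpace.generateFrom (boundedVoidEvents S)) _
      fun k => ?_
    induction k using ENat.recTopCoe with
    | top =>
      have : (fun η : PointPattern S => (η.points ∩ A).encard) ⁻¹' {⊤} =
          ⋂ k : ℕ, {η : PointPattern S | (k : ℕ∞) ≤ (η.points ∩ A).encard} := by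
        ext η
        simp [ENat.eq_top_iff_forall_ge]
      rw [this]
      exact MeasurableSet.iInter hle
    | coe k =>
      have : (fun η : PointPattern S => (η.points ∩ A).encard) ⁻¹' {(k : ℕ∞)} =
          {η : PointPattern S | (k : ℕ∞) ≤ (η.points ∩ A).encard} \
            {η : PointPattern S | ((k + 1 : ℕ) : ℕ∞) ≤ (η.points ∩ A).encard} := by
        ext η
        simp only [Set.mem_preimage, Set.mem_singleton_iff, Set.mem_sdiff, Set.mem_ofPred_eq, not_le]
        push_cast
        rw [ENat.lt_add_one_iff (ENat.natCast_ne_top k), le_antisymm_iff, and_comm]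
      rw [this]
      exact (hle k).diff (hle (k + 1))
  · refine MeasurableSpace.generateFrom_le ?_
    rintro _ ⟨A, hA, -, rfl⟩
    exact measurableSet_inter_eq_empty hA

theorem measurable_of_measurableSet_void {Ω : Type*} [MeasurableSpace Ω] {f : Ω → PointPattern S}
    (hf : ∀ A : Set S, MeasurableSet A → MeasurableSet {ω | (f ω).points ∩ A = ∅}) :
    Measurable f := by
  rw [instMeasurableSpace_eq_generateFrom]
  refine measurable_generateFrom ?_
  rintro _ ⟨A, hA, -, rfl⟩
  exact hf A hA

theorem measurableSet_points (η : PointPattern S) : MeasurableSet η.points :=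
  η.countable_points.measurableSet

/-- The counting measure of a point pattern, as a kernel. -/
noncomputable def pointKernel (S : Type*) [MetricSpace S] [MeasurableSpace S] [BorelSpace S]
    [SecondCountableTopology S] : Kernel (PointPattern S) S where
  toFun η := Measure.count.restrict η.points
  measurable' := by
    refine Measure.measurable_of_measurable_coe _ fun A hA => ?_
    have : (fun η : PointPattern S => (Measure.count.restrict η.points) A) =
        fun η => (((η.points ∩ A).encard : ℕ∞) : ℝ≥0∞) := by
      ext η
      rw [Measure.restrict_apply hA, Measure.count_apply (hA.inter η.measurableSet_points),
        Set.inter_comm]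
    rw [this]
    exact (measurable_from_top (f := ENat.toENNReal)).comp (measurable_encard_inter hA)

theorem pointKernel_apply (η : PointPattern S) {A : Set S} (hA : MeasurableSet A) :
    pointKernel S η A = ((η.points ∩ A).encard : ℕ∞) := by
  change (Measure.count.restrict η.points) A = _
  rw [Measure.restrict_apply hA, Measure.count_apply (hA.inter η.measurableSet_points),
    Set.inter_comm]

theorem lintegral_pointKernel (η : PointPattern S) (f : S → ℝ≥0∞) :
    ∫⁻ x, f x ∂pointKernel S η = ∑' x : η.points, f x := by
  change ∫⁻ x in η.points, f x ∂Measure.count = _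
  rw [lintegral_countable _ η.countable_points]
  simp

theorem ae_pointKernel_iff (η : PointPattern S) (q : S → Prop) :
    (∀ᵐ x ∂pointKernel S η, q x) ↔ ∀ x ∈ η.points, q x := by
  change (∀ᵐ x ∂Measure.count.restrict η.points, q x) ↔ _
  rw [ae_restrict_iff' η.measurableSet_points]
  simp [ae_iff, Measure.count_eq_zero_iff, Set.eq_empty_iff_forall_notMem]

/-- The number of points in a bounded set is finite but not uniformly bounded over patterns.
Splitting both by bounded shells `D n` of `S` and by the count `k` in the shell leaves pieces of
mass at most `k`. -/
instance : IsSFiniteKernel (pointKernel S) := by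
  classical
  rcases isEmpty_or_nonempty S with hS | ⟨⟨o⟩⟩
  · have : pointKernel S = 0 := by
      ext η A hA
      rw [pointKernel_apply _ hA]
      simp [Set.eq_empty_of_isEmpty]
    rw [this]; infer_instance
  let D : ℕ → Set S := disjointed fun n : ℕ => Metric.ball o n
  have hD : ∀ n, MeasurableSet (D n) := MeasurableSet.disjointed fun n => measurableSet_ball
  have hDb : ∀ n, Bornology.IsBounded (D n) := fun n =>
    Metric.isBounded_ball.subset (disjointed_subset _ n)
  have hE : ∀ n k : ℕ, MeasurableSet {η : PointPattern S | (η.points ∩ D n).encard = k} :=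
    fun n k => measurable_encard_inter (hD n) (measurableSet_singleton _)
  let κ : ℕ × ℕ → Kernel (PointPattern S) S := fun q =>
    Kernel.piecewise (hE q.1 q.2) ((pointKernel S).restrict (hD q.1)) 0
  have hκ : ∀ q η A, MeasurableSet A →
      κ q η A = if (η.points ∩ D q.1).encard = q.2 then pointKernel S η (A ∩ D q.1) else 0 := by
    intro q η A hA
    simp only [κ, Kernel.piecewise_apply, Set.mem_ofPred_eq]
    split_ifs
    · rw [Kernel.restrict_apply, Measure.restrict_apply hA]
    · simp
  have hfin : ∀ q, IsFiniteKernel (κ q) := fun q => by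
    refine ⟨q.2, by simp, fun η => ?_⟩
    rw [hκ _ _ _ MeasurableSet.univ]
    split_ifs with h
    · rw [Set.univ_inter, pointKernel_apply _ (hD _), h]; simp
    · simp
  have hsum : pointKernel S = Kernel.sum κ := by
    ext η A hA
    rw [Kernel.sum_apply' _ _ hA, ENNReal.tsum_prod']
    have h1 : ∀ n, ∑' k, κ (n, k) η A = pointKernel S η (A ∩ D n) := by
      intro n
      have hfi := η.finite_inter _ (hDb n)
      rw [tsum_eq_single (η.points ∩ D n).ncard]
      · rw [hκ _ _ _ hA, if_pos]
        exact hfi.cast_ncard_eq.symm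
      · intro k hk
        rw [hκ _ _ _ hA, if_neg]
        rw [← hfi.cast_ncard_eq]
        exact fun h => hk (by simpa using h.symm)
    simp_rw [h1]
    rw [← measure_iUnion, ← Set.inter_iUnion, iUnion_disjointed, Metric.iUnion_ball_nat,
      Set.inter_univ]
    · exact fun i j hij => ((disjoint_disjointed _) hij).mono Set.inter_subset_right
        Set.inter_subset_right
    · exact fun n => hA.inter (hD n)
  rw [hsum]
  infer_instance

section Shift

variable {G : Type*} [Group G] [MulAction G S] [IsIsometricSMul G S]

theorem measurable_shift (g : G) : Measurable fun η : PointPattern S => η.shift g := by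
  refine measurable_of_measurableSet_void fun A hA => ?_
  simp_rw [shift_points_inter_eq_empty]
  exact measurableSet_inter_eq_empty ((isometry_smul S g).continuous.measurable hA)

theorem lintegral_pointKernel_shift (g : G) (η : PointPattern S) (f : S → ℝ≥0∞) :
    ∫⁻ x, f x ∂pointKernel S (η.shift g) = ∫⁻ x, f (g • x) ∂pointKernel S η := by
  simp_rw [lintegral_pointKernel]
  exact tsum_image f (MulAction.injective g).injOn

end Shift

end PointPattern

/-! ### Haar measure and the mass transport principle -/

section MassTransport

open Topology Filter Pointwise

variable {S G : Type*} [MetricSpace S] [MeasurableSpace S] [BorelSpace S]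
  [Group G] [TopologicalSpace G] [IsTopologicalGroup G] [MeasurableSpace G] [BorelSpace G]
  [MulAction G S] [ContinuousSMul G S]

/-- The orbit map is open, so a compact neighbourhood `K` of `1` carries `o` onto a set containing a
ball. Every `g` that moves `o` into this ball lies in `K` times the stabilizer, which is compact. -/
theorem eventually_haar_smul_mem_ball_lt_top [CompleteSpace S]
    [LocallyCompactSpace G] [SecondCountableTopology G] [MulAction.IsPretransitive G S]
    (o : S) (hstab : IsCompact (MulAction.stabilizer G o : Set G))
    (ν : Measure G) [ν.IsHaarMeasure] :
    ∀ᶠ r in 𝓝[>] (0 : ℝ), ν {g : G | g • o ∈ Metric.ball o r} < ∞ := by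
  obtain ⟨K, hK, hK1⟩ := exists_compact_mem_nhds (1 : G)
  have hmem : (fun g : G => g • o) '' K ∈ 𝓝 o := by
    simpa using (isOpenMap_smul_of_sigmaCompact (G := G) o).image_mem_nhds hK1
  obtain ⟨ε, hε, hball⟩ := Metric.mem_nhds_iff.1 hmem
  filter_upwards [Ioo_mem_nhdsGT hε] with r hr
  refine (measure_mono ?_).trans_lt (hK.mul hstab).measure_lt_top
  intro g hg
  obtain ⟨k, hk, hkg⟩ := hball (Metric.ball_subset_ball hr.2.le hg)
  refine ⟨k, hk, k⁻¹ * g, ?_, by simp⟩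
  have hkg' : k • o = g • o := hkg
  simp [MulAction.mem_stabilizer_iff, mul_smul, ← hkg']

theorem haar_smul_mem_ball_pos (o : S) {r : ℝ} (hr : 0 < r) (ν : Measure G) [ν.IsHaarMeasure] :
    0 < ν {g : G | g • o ∈ Metric.ball o r} := by
  refine IsOpen.measure_pos ν ?_ ⟨1, by simpa using hr⟩
  exact Metric.isOpen_ball.preimage (continuous_id.smul continuous_const)

/-- Changing the base point translates `g` on the right here, and on the left in
`haar_inv_smul_mem`. Unimodularity makes both available for one Haar measure. -/
theorem haar_smul_mem [MulAction.IsPretransitive G S] (o x : S) (A : Set S)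
    (ν : Measure G) [ν.IsMulRightInvariant] :
    ν {g : G | g • x ∈ A} = ν {g : G | g • o ∈ A} := by
  obtain ⟨k, rfl⟩ := MulAction.exists_smul_eq G o x
  rw [← measure_preimage_mul_right ν k {g : G | g • o ∈ A}]
  simp [Set.preimage, mul_smul]

theorem haar_inv_smul_mem [MulAction.IsPretransitive G S] (o x : S) (A : Set S)
    (ν : Measure G) [ν.IsMulLeftInvariant] :
    ν {g : G | g⁻¹ • x ∈ A} = ν {g : G | g⁻¹ • o ∈ A} := by
  obtain ⟨k, rfl⟩ := MulAction.exists_smul_eq G x o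
  rw [← measure_preimage_mul ν k {g : G | g⁻¹ • k • x ∈ A}]
  simp [Set.preimage, mul_smul]

theorem inv_smul_mem_ball_iff [IsIsometricSMul G S] (o : S) (r : ℝ) (g : G) :
    g⁻¹ • o ∈ Metric.ball o r ↔ g • o ∈ Metric.ball o r := by
  rw [Metric.mem_ball, Metric.mem_ball, ← dist_smul g (g⁻¹ • o) o, smul_inv_smul, dist_comm]

/-- The mass transport principle: a diagonally invariant measure on `S × S` gives a small ball
the same total outgoing and incoming mass. -/
theorem mass_transport_ball [SecondCountableTopology S] [SecondCountableTopology G]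
    [LocallyCompactSpace G]
    [MulAction.IsPretransitive G S] [IsIsometricSMul G S]
    (ν : Measure G) [ν.IsHaarMeasure] [ν.IsMulRightInvariant]
    (M : Measure (S × S)) [SFinite M]
    (hM : ∀ (g : G) (f : S × S → ℝ≥0∞), Measurable f →
      ∫⁻ z, f (g • z.1, g • z.2) ∂M = ∫⁻ z, f z ∂M)
    (o : S) {r : ℝ} (hr : 0 < r) (hfin : ν {g : G | g • o ∈ Metric.ball o r} < ∞) :
    M (Prod.fst ⁻¹' Metric.ball o r) = M (Prod.snd ⁻¹' Metric.ball o r) := by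
  set A := Metric.ball o r
  set c := ν {g : G | g • o ∈ A}
  have hA : MeasurableSet A := measurableSet_ball
  have hc0 : c ≠ 0 := (haar_smul_mem_ball_pos o hr ν).ne'
  have hsm : Measurable fun q : G × S => q.1 • q.2 := measurable_smul
  have hsm' : Measurable fun q : G × S => q.1⁻¹ • q.2 :=
    hsm.comp (measurable_fst.inv.prodMk measurable_snd)
  have h1 : ∀ x, ∫⁻ g, A.indicator (1 : S → ℝ≥0∞) (g • x) ∂ν = c := fun x => by
    have := lintegral_indicator_one (μ := ν) (s := {g : G | g • x ∈ A})
      ((hsm.comp (measurable_id.prodMk measurable_const)) hA)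
    rw [haar_smul_mem o] at this
    exact this
  have h2 : ∀ x, ∫⁻ g, A.indicator (1 : S → ℝ≥0∞) (g⁻¹ • x) ∂ν = c := fun x => by
    have := lintegral_indicator_one (μ := ν) (s := {g : G | g⁻¹ • x ∈ A})
      ((hsm'.comp (measurable_id.prodMk measurable_const)) hA)
    rw [haar_inv_smul_mem o] at this
    -- A ball centred at the base point is symmetric under `g ↦ g⁻¹`, so the constant is the same
    -- `c` as in `h1`.
    simp_rw [A, inv_smul_mem_ball_iff] at this
    exact this
  have hI : Measurable (A.indicator (1 : S → ℝ≥0∞)) := measurable_one.indicator hA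
  have hfst : Measurable fun z : S × S => A.indicator (1 : S → ℝ≥0∞) z.1 := hI.comp measurable_fst
  have hsnd : Measurable fun z : S × S => A.indicator (1 : S → ℝ≥0∞) z.2 := hI.comp measurable_snd
  have hsx : ∀ x, Measurable fun g : G => A.indicator (1 : S → ℝ≥0∞) (g • x) := fun x =>
    hI.comp (hsm.comp (measurable_id.prodMk measurable_const))
  have hsx' : ∀ x, Measurable fun g : G => A.indicator (1 : S → ℝ≥0∞) (g⁻¹ • x) := fun x =>
    hI.comp (hsm'.comp (measurable_id.prodMk measurable_const))
  have key : M (Prod.fst ⁻¹' A) * c = M (Prod.snd ⁻¹' A) * c := by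
    calc M (Prod.fst ⁻¹' A) * c
        = ∫⁻ z : S × S, A.indicator 1 z.1 * c ∂M := by
          rw [lintegral_mul_const _ hfst]
          congr 1
          exact (lintegral_indicator_one (measurable_fst hA)).symm
      _ = ∫⁻ z : S × S, ∫⁻ g, A.indicator 1 z.1 * A.indicator 1 (g • z.2) ∂ν ∂M := by
          refine lintegral_congr fun z => ?_
          rw [lintegral_const_mul _ (hsx _), h1]
      _ = ∫⁻ g, ∫⁻ z : S × S, A.indicator 1 z.1 * A.indicator 1 (g • z.2) ∂M ∂ν := by
          refine lintegral_lintegral_swap (Measurable.aemeasurable ?_)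
          exact (hI.comp (measurable_fst.comp measurable_fst)).mul
            (hI.comp (hsm.comp (measurable_snd.prodMk (measurable_snd.comp measurable_fst))))
      -- Diagonal invariance of `M` moves the group element from the second coordinate to the first.
      _ = ∫⁻ g, ∫⁻ z : S × S, A.indicator 1 (g⁻¹ • z.1) * A.indicator 1 z.2 ∂M ∂ν := by
          refine lintegral_congr fun g => ?_
          rw [← hM g fun z : S × S => A.indicator 1 (g⁻¹ • z.1) * A.indicator 1 z.2]
          · simp
          · exact (hI.comp (hsm'.comp (measurable_const.prodMk measurable_fst))).mul
              (hI.comp measurable_snd)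
      _ = ∫⁻ z : S × S, ∫⁻ g, A.indicator 1 (g⁻¹ • z.1) * A.indicator 1 z.2 ∂ν ∂M := by
          refine (lintegral_lintegral_swap (Measurable.aemeasurable ?_)).symm
          exact (hI.comp (hsm'.comp (measurable_snd.prodMk
            (measurable_fst.comp measurable_fst)))).mul
            (hI.comp (measurable_snd.comp measurable_fst))
      _ = ∫⁻ z : S × S, A.indicator 1 z.2 * c ∂M := by
          refine lintegral_congr fun z => ?_
          rw [lintegral_mul_const _ (hsx' _), h2, mul_comm]
      _ = M (Prod.snd ⁻¹' A) * c := by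
          rw [lintegral_mul_const _ hsnd]
          congr 1
          exact lintegral_indicator_one (measurable_snd hA)
  exact (ENNReal.mul_left_inj hc0 hfin.ne).1 key

/-- All balls of radius `r` are translates of one another; if one were null, `μ` would be locally
null, hence zero. -/
theorem measure_ball_pos_of_isPretransitive [SecondCountableTopology S]
    [MulAction.IsPretransitive G S] [IsIsometricSMul G S]
    (μ : Measure S) [SMulInvariantMeasure G S μ] (hμ : μ ≠ 0) (o : S) {r : ℝ} (hr : 0 < r) :
    0 < μ (Metric.ball o r) := by
  refine pos_iff_ne_zero.2 fun h0 => hμ ?_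
  have hx : ∀ x, μ (Metric.ball x r) = 0 := fun x => by
    obtain ⟨k, rfl⟩ := MulAction.exists_smul_eq G x o
    rw [← Metric.smul_ball] at h0
    rwa [measure_smul] at h0
  rw [← Measure.measure_univ_eq_zero]
  exact measure_null_of_locally_null _ fun x _ =>
    ⟨Metric.ball x r, mem_nhdsWithin_of_mem_nhds (Metric.ball_mem_nhds x hr), hx x⟩

end MassTransport

/-! ### Law of a thinning: void probabilities, intensity, stationarity -/

section ThinningLaw

variable {Ω S : Type*} [MeasurableSpace Ω] [MetricSpace S] [MeasurableSpace S]

theorem measure_forall_mem_eq_false {P : Measure Ω} [IsProbabilityMeasure P] {b : ℕ → Ω → Bool}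
    (hb : ∀ n, Measurable (b n)) {p : ℝ≥0∞} (hp : ∀ n, P {ω | b n ω = true} = p)
    (hind : iIndepFun b P) {I : Set ℕ} (hI : I.Finite) :
    P {ω | ∀ n ∈ I, b n ω = false} = (1 - p) ^ I.ncard := by
  have h := (iIndepFun_iff_measure_inter_preimage_eq_mul.1 hind) hI.toFinset
    (sets := fun _ => {false}) (fun _ _ => measurableSet_singleton _)
  have hs : (⋂ i ∈ hI.toFinset, b i ⁻¹' {false}) = {ω | ∀ n ∈ I, b n ω = false} := by
    ext ω; simp
  have hq : ∀ n, P (b n ⁻¹' {false}) = 1 - p := fun n => by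
    have hc : b n ⁻¹' {false} = {ω | b n ω = true}ᶜ := by ext ω; simp
    have hm : MeasurableSet {ω | b n ω = true} := hb n (measurableSet_singleton true)
    rw [hc, prob_compl_eq_one_sub hm, hp]
  rw [hs] at h
  rw [h]
  simp [hq, Set.ncard_eq_toFinset_card I hI]

theorem tsum_indicator_one_eq_encard (I : Set ℕ) :
    ∑' n, I.indicator (1 : ℕ → ℝ≥0∞) n = (I.encard : ℝ≥0∞) := by
  rw [← tsum_subtype, ← ENNReal.tsum_set_one]
  rfl

theorem encard_image_inter_of_injOn {ξ : ℕ → S} {J J' : Set ℕ} (hinj : Set.InjOn ξ J')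
    (hJ : J ⊆ J') (A : Set S) : (ξ '' J ∩ A).encard = {n | n ∈ J ∧ ξ n ∈ A}.encard := by
  rw [← (hinj.mono (fun n (hn : n ∈ {n | n ∈ J ∧ ξ n ∈ A}) => hJ hn.1)).encard_image]
  congr 1
  ext x
  constructor
  · rintro ⟨⟨n, hn, rfl⟩, hA⟩
    exact ⟨n, ⟨hn, hA⟩, rfl⟩
  · rintro ⟨n, ⟨hn, hA⟩, rfl⟩
    exact ⟨⟨n, hn, rfl⟩, hA⟩

variable [BorelSpace S] [SecondCountableTopology S]

/-- A `p`-thinning has a measurable modification, and its void probabilities and its intensity are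
determined by the point counts of the original process. -/
theorem exists_measurable_modification_thinning (P : Measure Ω) [IsProbabilityMeasure P]
    {X Y : Ω → PointPattern S} {p : ℝ≥0∞} {N : Ω → ℕ∞} {ξ : ℕ → Ω → S} {b : ℕ → Ω → Bool}
    (hN : Measurable N) (hξ : ∀ n, Measurable (ξ n)) (hb : ∀ n, Measurable (b n))
    (hX : ∀ᵐ ω ∂P, Set.InjOn (fun n => ξ n ω) {n : ℕ | (n : ℕ∞) < N ω} ∧
      (X ω).points = (fun n => ξ n ω) '' {n : ℕ | (n : ℕ∞) < N ω})
    (hp : ∀ n, P {ω | b n ω = true} = p) (hind : iIndepFun b P)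
    (hNξb : IndepFun (fun ω => (N ω, fun n => ξ n ω)) (fun ω n => b n ω) P)
    (hY : ∀ᵐ ω ∂P,
      (Y ω).points = (fun n => ξ n ω) '' {n : ℕ | (n : ℕ∞) < N ω ∧ b n ω = true}) :
    ∃ Z : Ω → PointPattern S, Measurable Z ∧ Z =ᵐ[P] Y ∧
      (∀ A : Set S, MeasurableSet A → Bornology.IsBounded A →
        P {ω | (Z ω).points ∩ A = ∅} =
          ∫⁻ ω, (1 - p) ^ ((X ω).points ∩ A).encard.toNat ∂P) ∧
      ∀ A : Set S, MeasurableSet A →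
        ∫⁻ ω, (((Z ω).points ∩ A).encard : ℝ≥0∞) ∂P =
          p * ∫⁻ ω, (((X ω).points ∩ A).encard : ℝ≥0∞) ∂P := by
  classical
  have hlt : ∀ n : ℕ, MeasurableSet {ω | (n : ℕ∞) < N ω} := fun n =>
    hN (Set.to_countable {k | (n : ℕ∞) < k}).measurableSet
  obtain ⟨T, hTsub, hTm, hT⟩ : ∃ T : Set Ω, (∀ ω ∈ T,
      (Y ω).points = (fun n => ξ n ω) '' {n : ℕ | (n : ℕ∞) < N ω ∧ b n ω = true}) ∧
      MeasurableSet T ∧ ∀ᵐ ω ∂P, ω ∈ T := by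
    obtain ⟨T, hTs, hTm, hT⟩ := exists_measurable_superset_of_null (ae_iff.1 hY)
    refine ⟨Tᶜ, fun ω hω => ?_, hTm.compl, ?_⟩
    · by_contra h
      exact hω (hTs h)
    · rw [ae_iff]; simpa using hT
  -- `Y` is described only almost surely; replacing it by the empty pattern off the measurable set
  -- `T` makes its void events measurable.
  let Z : Ω → PointPattern S := fun ω =>
    if ω ∈ T then Y ω else ⟨∅, fun B _ => by simp⟩
  have hZY : Z =ᵐ[P] Y := by
    filter_upwards [hT] with ω hω
    simp [Z, hω]
  have hZvoid : ∀ A : Set S, ∀ ω ∈ T, ((Z ω).points ∩ A = ∅ ↔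
      ∀ n : ℕ, (n : ℕ∞) < N ω → ξ n ω ∈ A → b n ω = false) := by
    intro A ω hω
    simp only [Z, if_pos hω, hTsub ω hω, Set.eq_empty_iff_forall_notMem]
    constructor
    · intro h n hn hA
      by_contra hbn
      exact h (ξ n ω) ⟨⟨n, ⟨hn, by simpa using hbn⟩, rfl⟩, hA⟩
    · rintro h _ ⟨⟨n, ⟨hn, hbn⟩, rfl⟩, hA⟩
      simp [h n hn hA] at hbn
  have hZm : Measurable Z := by
    refine PointPattern.measurable_of_measurableSet_void fun A hA => ?_
    have : {ω | (Z ω).points ∩ A = ∅} = Tᶜ ∪ (T ∩ ⋂ n : ℕ,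
        ({ω | (n : ℕ∞) < N ω}ᶜ ∪ (ξ n ⁻¹' A)ᶜ ∪ b n ⁻¹' {false})) := by
      ext ω
      by_cases hω : ω ∈ T
      · simp only [Set.mem_ofPred_eq, hZvoid A ω hω]
        simp [hω]
        grind
      · simp [Z, hω]
    rw [this]
    exact hTm.compl.union (hTm.inter (MeasurableSet.iInter fun n =>
      ((hlt n).compl.union (hξ n hA).compl).union (hb n (measurableSet_singleton _))))
  refine ⟨Z, hZm, hZY, fun A hA hAb => ?_, fun A hA => ?_⟩
  -- The void event as a condition on points and marks. Independence makes their joint law a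
  -- product, so the points can be frozen while the marks are integrated out.
  · let H : Set ((ℕ∞ × (ℕ → S)) × (ℕ → Bool)) :=
      {v | ∀ n : ℕ, (n : ℕ∞) < v.1.1 → v.1.2 n ∈ A → v.2 n = false}
    have hH : MeasurableSet H := by
      have : H = ⋂ n : ℕ, ((fun v => v.1.1) ⁻¹' {k : ℕ∞ | (n : ℕ∞) < k}ᶜ ∪
          (fun v => v.1.2 n) ⁻¹' Aᶜ ∪ (fun v => v.2 n) ⁻¹' {false}) := by
        ext v
        simp [H]
        grind
      rw [this]
      refine MeasurableSet.iInter fun n => ((MeasurableSet.union ?_ ?_).union ?_)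
      · exact (measurable_fst.comp measurable_fst) (Set.to_countable _).measurableSet
      · exact ((measurable_pi_apply n).comp (measurable_snd.comp measurable_fst)) hA.compl
      · exact ((measurable_pi_apply n).comp measurable_snd) (measurableSet_singleton _)
    have hVm : Measurable fun ω => (N ω, fun n => ξ n ω) := hN.prodMk (measurable_pi_lambda _ hξ)
    have hbm : Measurable fun ω n => b n ω := measurable_pi_lambda _ hb
    have hprod := hNξb.map_prod_eq_prod_map_map hVm.aemeasurable hbm.aemeasurable
    have := Measure.isProbabilityMeasure_map (μ := P) hbm.aemeasurable
    calc P {ω | (Z ω).points ∩ A = ∅}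
        = P ((fun ω => ((N ω, fun n => ξ n ω), fun n => b n ω)) ⁻¹' H) := by
          refine measure_congr ?_
          filter_upwards [hT] with ω hω
          exact propext (hZvoid A ω hω)
      _ = ∫⁻ ω, P {ω' | ∀ n ∈ {n : ℕ | (n : ℕ∞) < N ω ∧ ξ n ω ∈ A}, b n ω' = false} ∂P := by
          rw [← Measure.map_apply (hVm.prodMk hbm) hH, hprod, Measure.prod_apply hH,
            lintegral_map (measurable_measure_prodMk_left hH) hVm]
          refine lintegral_congr fun ω => ?_
          rw [Measure.map_apply hbm (measurable_prodMk_left hH)]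
          congr 1
          ext ω'
          simp [H]
      _ = ∫⁻ ω, (1 - p) ^ ((X ω).points ∩ A).encard.toNat ∂P := by
          refine lintegral_congr_ae ?_
          filter_upwards [hX] with ω hω
          have hcard : ((X ω).points ∩ A).encard =
              {n : ℕ | (n : ℕ∞) < N ω ∧ ξ n ω ∈ A}.encard := by
            rw [hω.2]
            exact encard_image_inter_of_injOn hω.1 subset_rfl A
          -- Boundedness of `A` enters here: finitely many marks matter, and `toNat` returns the
          -- true count.
          have hfin : {n : ℕ | (n : ℕ∞) < N ω ∧ ξ n ω ∈ A}.Finite := by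
            rw [← Set.encard_lt_top_iff, ← hcard, Set.encard_lt_top_iff]
            exact (X ω).finite_inter A hAb
          rw [hcard]
          exact measure_forall_mem_eq_false hb hp hind hfin
  · let E : ℕ → Set Ω := fun n => {ω | (n : ℕ∞) < N ω ∧ ξ n ω ∈ A}
    have hE : ∀ n, MeasurableSet (E n) := fun n => (hlt n).inter (hξ n hA)
    have hEb : ∀ n, MeasurableSet (E n ∩ b n ⁻¹' {true}) := fun n =>
      (hE n).inter (hb n (measurableSet_singleton _))
    have hXsum : ∫⁻ ω, (((X ω).points ∩ A).encard : ℝ≥0∞) ∂P = ∑' n, P (E n) := by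
      simp_rw [← lintegral_indicator_one (hE _)]
      rw [← lintegral_tsum fun n => (measurable_one.indicator (hE n)).aemeasurable]
      refine lintegral_congr_ae ?_
      filter_upwards [hX] with ω hω
      rw [hω.2, encard_image_inter_of_injOn hω.1 subset_rfl, ← tsum_indicator_one_eq_encard]
      refine tsum_congr fun n => ?_
      simp [Set.indicator_apply, E]
    have hZsum : ∫⁻ ω, (((Z ω).points ∩ A).encard : ℝ≥0∞) ∂P =
        ∑' n, P (E n ∩ b n ⁻¹' {true}) := by
      simp_rw [← lintegral_indicator_one (hEb _)]
      rw [← lintegral_tsum fun n => (measurable_one.indicator (hEb n)).aemeasurable]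
      refine lintegral_congr_ae ?_
      filter_upwards [hX, hY, hZY] with ω hω hω' hω''
      rw [hω'', hω', encard_image_inter_of_injOn hω.1 fun n hn => hn.1,
        ← tsum_indicator_one_eq_encard]
      refine tsum_congr fun n => ?_
      simp [Set.indicator_apply, E, and_right_comm]
    rw [hXsum, hZsum, ← ENNReal.tsum_mul_left]
    -- The mark of the `n`-th point is independent of its existence and location, so each term
    -- acquires a factor `p`.
    refine tsum_congr fun n => ?_
    have hs : MeasurableSet {v : ℕ∞ × (ℕ → S) | (n : ℕ∞) < v.1 ∧ v.2 n ∈ A} :=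
      (measurable_fst (Set.to_countable {k : ℕ∞ | (n : ℕ∞) < k}).measurableSet).inter
        (((measurable_pi_apply n).comp measurable_snd) hA)
    have ht : MeasurableSet {w : ℕ → Bool | w n = true} :=
      (measurable_pi_apply (X := fun _ : ℕ => Bool) n) (measurableSet_singleton true)
    have := hNξb.measure_inter_preimage_eq_mul _ _ hs ht
    rw [mul_comm, ← hp n]
    exact this

/-- The law of a thinning inherits stationarity. -/
theorem map_shift_of_void_eq {G : Type*} [Group G] [MulAction G S] [IsIsometricSMul G S]
    (P : Measure Ω) [IsProbabilityMeasure P] {X Z : Ω → PointPattern S}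
    (hstat : IsStationaryProcess G P X) (hZ : Measurable Z) (F : ℕ∞ → ℝ≥0∞)
    (hvoid : ∀ A : Set S, MeasurableSet A → Bornology.IsBounded A →
      P {ω | (Z ω).points ∩ A = ∅} = ∫⁻ ω, F ((X ω).points ∩ A).encard ∂P) (g : G) :
    (P.map Z).map (fun η => η.shift g) = P.map Z := by
  have := Measure.isProbabilityMeasure_map (μ := P) hZ.aemeasurable
  have hsh := PointPattern.measurable_shift (S := S) g
  refine ext_of_generate_finite _ PointPattern.instMeasurableSpace_eq_generateFrom
    PointPattern.isPiSystem_boundedVoidEvents ?_ ?_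
  · rintro _ ⟨A, hA, hAb, rfl⟩
    have hA' : MeasurableSet ((fun x : S => g • x) ⁻¹' A) :=
      (isometry_smul S g).continuous.measurable hA
    have hAb' : Bornology.IsBounded ((fun x : S => g • x) ⁻¹' A) :=
      (isometry_smul S g).antilipschitz.isBounded_preimage hAb
    have hv := PointPattern.measurableSet_inter_eq_empty hA
    have hpre : (fun η : PointPattern S => η.shift g) ⁻¹' {η | η.points ∩ A = ∅} =
        {η | η.points ∩ (fun x : S => g • x) ⁻¹' A = ∅} := by
      ext η
      exact PointPattern.shift_points_inter_eq_empty g η A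
    rw [Measure.map_apply hsh hv, hpre, Measure.map_apply hZ hv,
      Measure.map_apply hZ (PointPattern.measurableSet_inter_eq_empty hA')]
    change P {ω | (Z ω).points ∩ _ = ∅} = P {ω | (Z ω).points ∩ _ = ∅}
    -- Both sides become expectations of `F` of counts of `X`, which agree by stationarity of `X`.
    rw [hvoid A hA hAb, hvoid _ hA' hAb']
    simp_rw [← PointPattern.encard_shift_points_inter]
    exact ((hstat g).comp ((measurable_from_top (f := F)).comp
      (PointPattern.measurable_encard_inter hA))).lintegral_eq
  · rw [Measure.map_apply hsh MeasurableSet.univ, Set.preimage_univ]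

end ThinningLaw

/-! ### Voronoi cells: measurability, overlaps and equivariance -/

section VoronoiMeasurability

variable {S : Type*} [MetricSpace S]

/-- The ball is open, so `x` never lies in it and need not be excluded. Cell membership is thus a
void event, from which measurability and equivariance follow. -/
theorem mem_voronoiCell_univ_iff (η : PointPattern S) (x u : S) :
    u ∈ voronoiCell Set.univ η x ↔ η.points ∩ Metric.ball u (dist x u) = ∅ := by
  simp only [voronoiCell, Set.mem_univ, true_and, Set.eq_empty_iff_forall_notMem, Set.mem_inter_iff,
    Metric.mem_ball, not_and, not_lt, Set.mem_sdiff, Set.mem_singleton_iff, Set.mem_ofPred_eq]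
  constructor
  · intro h y hy
    by_cases hyx : y = x
    · rw [hyx]
    · exact h y ⟨hy, hyx⟩
  · exact fun h y hy => h y hy.1

theorem smul_mem_voronoiCell_shift_iff {G : Type*} [Group G] [MulAction G S] [IsIsometricSMul G S]
    (g : G) (η : PointPattern S) (x u : S) :
    g • u ∈ voronoiCell Set.univ (η.shift g) (g • x) ↔ u ∈ voronoiCell Set.univ η x := by
  rw [mem_voronoiCell_univ_iff, mem_voronoiCell_univ_iff,
    PointPattern.shift_points_inter_eq_empty, dist_smul]
  have : (fun y : S => g • y) ⁻¹' Metric.ball (g • u) (dist x u) = Metric.ball u (dist x u) := by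
    ext y; simp
  rw [this]

theorem exists_ball_subset_voronoiCell (η : PointPattern S) (x : S) :
    ∃ r > 0, Metric.ball x r ⊆ voronoiCell Set.univ η x := by
  have hfin : ((η.points ∩ Metric.ball x 1) \ {x}).Finite :=
    (η.finite_inter _ Metric.isBounded_ball).sdiff
  obtain ⟨ε, hε, hball⟩ := Metric.mem_nhds_iff.1 (hfin.isClosed.isOpen_compl.mem_nhds
    (show x ∈ ((η.points ∩ Metric.ball x 1) \ {x})ᶜ by simp))
  -- Half the separation radius suffices: a point closer to `u` than `x` is within twice this radius
  -- of `x`.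
  refine ⟨min ε 1 / 2, by positivity, fun u hu => (mem_voronoiCell_univ_iff η x u).2 ?_⟩
  rw [Set.eq_empty_iff_forall_notMem]
  rintro y ⟨hy, hyu⟩
  rw [Metric.mem_ball] at hu hyu
  have hxy : dist y x < min ε 1 := by
    have := dist_triangle y u x
    rw [dist_comm x u] at hyu
    linarith
  have hne : y ≠ x := by
    rintro rfl
    exact lt_irrefl _ hyu
  exact hball (Metric.mem_ball.2 (hxy.trans_le (min_le_left _ _)))
    ⟨⟨hy, Metric.mem_ball.2 (hxy.trans_le (min_le_right _ _))⟩, hne⟩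

/-- Hitting a ball with varying centre and radius becomes a countable union over fixed balls, as
joint measurability in `(η, x, u)` requires. -/
theorem inter_ball_nonempty_iff_exists_denseSeq [TopologicalSpace.SeparableSpace S] [Nonempty S]
    (s : Set S) (u : S) (r : ℝ) : (s ∩ Metric.ball u r).Nonempty ↔
      ∃ (n : ℕ) (t : ℚ), dist u (TopologicalSpace.denseSeq S n) + t < r ∧
        (s ∩ Metric.ball (TopologicalSpace.denseSeq S n) t).Nonempty := by
  constructor
  · rintro ⟨y, hys, hyu⟩
    rw [Metric.mem_ball] at hyu
    have hε : 0 < (r - dist y u) / 3 := by linarith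
    obtain ⟨n, hn⟩ := (TopologicalSpace.denseRange_denseSeq S).exists_dist_lt y hε
    obtain ⟨t, ht1, ht2⟩ := exists_rat_btwn hn
    refine ⟨n, t, ?_, y, hys, ht1⟩
    have := dist_triangle u y (TopologicalSpace.denseSeq S n)
    rw [dist_comm u y] at this
    linarith
  · rintro ⟨n, t, hlt, y, hys, hy⟩
    refine ⟨y, hys, ?_⟩
    rw [Metric.mem_ball] at hy ⊢
    have := dist_triangle y (TopologicalSpace.denseSeq S n) u
    rw [dist_comm u] at hlt
    linarith

variable [MeasurableSpace S] [BorelSpace S] [SecondCountableTopology S]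

theorem measurableSet_mem_voronoiCell :
    MeasurableSet {q : (PointPattern S × S) × S | q.2 ∈ voronoiCell Set.univ q.1.1 q.1.2} := by
  rcases isEmpty_or_nonempty S with hS | hS
  · convert! MeasurableSet.empty
    ext q
    exact hS.elim q.2
  have : {q : (PointPattern S × S) × S | q.2 ∈ voronoiCell Set.univ q.1.1 q.1.2} =
      (⋃ n : ℕ, ⋃ t : ℚ,
        {q | dist q.2 (TopologicalSpace.denseSeq S n) + t < dist q.1.2 q.2} ∩
        (fun q => q.1.1) ⁻¹'
          {η : PointPattern S | η.points ∩ Metric.ball (TopologicalSpace.denseSeq S n) t = ∅}ᶜ)ᶜ := by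
    ext q
    rw [Set.mem_ofPred_eq, mem_voronoiCell_univ_iff, ← Set.not_nonempty_iff_eq_empty,
      inter_ball_nonempty_iff_exists_denseSeq]
    simp [Set.nonempty_iff_ne_empty]
  rw [this]
  refine (MeasurableSet.iUnion fun n => MeasurableSet.iUnion fun t =>
    MeasurableSet.inter ?_ ?_).compl
  · exact measurableSet_lt
      ((measurable_snd.dist measurable_const).add measurable_const)
      ((measurable_snd.comp measurable_fst).dist measurable_snd)
  · exact (measurable_fst.comp measurable_fst)
      (PointPattern.measurableSet_inter_eq_empty measurableSet_ball).compl

/-- The indicator function `1{u ∈ 𝒱_x(η)}` as a function of `((η, x), u)`. -/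
noncomputable def voronoiIndicator (q : (PointPattern S × S) × S) : ℝ≥0∞ :=
  {q : (PointPattern S × S) × S | q.2 ∈ voronoiCell Set.univ q.1.1 q.1.2}.indicator 1 q

theorem measurable_voronoiIndicator :
    Measurable (voronoiIndicator (S := S)) :=
  measurable_one.indicator measurableSet_mem_voronoiCell

theorem voronoiIndicator_of_mem {η : PointPattern S} {x u : S}
    (h : u ∈ voronoiCell Set.univ η x) : voronoiIndicator ((η, x), u) = 1 :=
  Set.indicator_of_mem (s := {q : (PointPattern S × S) × S | q.2 ∈ voronoiCell Set.univ q.1.1 q.1.2})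
    h _

theorem voronoiIndicator_of_notMem {η : PointPattern S} {x u : S}
    (h : u ∉ voronoiCell Set.univ η x) : voronoiIndicator ((η, x), u) = 0 :=
  Set.indicator_of_notMem
    (s := {q : (PointPattern S × S) × S | q.2 ∈ voronoiCell Set.univ q.1.1 q.1.2}) h _

theorem measurable_measure_voronoiCell (μ : Measure S) [SFinite μ] :
    Measurable fun q : PointPattern S × S => μ (voronoiCell Set.univ q.1 q.2) :=
  measurable_measure_prodMk_left measurableSet_mem_voronoiCell

theorem lintegral_voronoiIndicator (μ : Measure S) (η : PointPattern S) (x : S) :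
    ∫⁻ u, voronoiIndicator ((η, x), u) ∂μ = μ (voronoiCell Set.univ η x) := by
  have : MeasurableSet (voronoiCell Set.univ η x) :=
    measurable_prodMk_left (x := (η, x)) measurableSet_mem_voronoiCell
  rw [← lintegral_indicator_one this]
  rfl

/-- The contribution `1{u ∈ 𝒱_x(η)} / |𝒱_x(η)|` of the point `x` to the Voronoi estimator. -/
noncomputable def voronoiWeight (μ : Measure S) (q : (PointPattern S × S) × S) : ℝ≥0∞ :=
  voronoiIndicator q * (μ (voronoiCell Set.univ q.1.1 q.1.2))⁻¹

theorem measurable_voronoiWeight (μ : Measure S) [SFinite μ] :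
    Measurable (voronoiWeight μ) :=
  measurable_voronoiIndicator.mul ((measurable_measure_voronoiCell μ).comp measurable_fst).inv

/-- The number of Voronoi cells which cover a location. -/
noncomputable def voronoiCoverage (q : PointPattern S × S) : ℝ≥0∞ :=
  ∫⁻ x, voronoiIndicator ((q.1, x), q.2) ∂PointPattern.pointKernel S q.1

/-- The Voronoi estimator without a tie-breaking rule. -/
noncomputable def voronoiWeightSum (μ : Measure S) (q : PointPattern S × S) : ℝ≥0∞ :=
  ∫⁻ x, voronoiWeight μ ((q.1, x), q.2) ∂PointPattern.pointKernel S q.1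

theorem PointPattern.measurable_lintegral_pointKernel {φ : (PointPattern S × S) × S → ℝ≥0∞}
    (hφ : Measurable φ) : Measurable fun q : PointPattern S × S =>
      ∫⁻ x, φ ((q.1, x), q.2) ∂pointKernel S q.1 := by
  have h : Measurable fun v : (PointPattern S × S) × S => φ ((v.1.1, v.2), v.1.2) :=
    hφ.comp (((measurable_fst.comp measurable_fst).prodMk measurable_snd).prodMk
      (measurable_snd.comp measurable_fst))
  exact h.lintegral_kernel_prod_right' (κ := (pointKernel S).prodMkRight S)

theorem measurable_voronoiCoverage : Measurable (voronoiCoverage (S := S)) :=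
  PointPattern.measurable_lintegral_pointKernel measurable_voronoiIndicator

theorem measurable_voronoiWeightSum (μ : Measure S) [SFinite μ] :
    Measurable (voronoiWeightSum μ) :=
  PointPattern.measurable_lintegral_pointKernel (measurable_voronoiWeight μ)

theorem eq_of_voronoiCoverage_le_one {η : PointPattern S} {u : S}
    (h : voronoiCoverage (η, u) ≤ 1) {x y : S} (hx : x ∈ η.points) (hy : y ∈ η.points)
    (hux : u ∈ voronoiCell Set.univ η x) (huy : u ∈ voronoiCell Set.univ η y) : x = y := by
  classical
  by_contra hne
  rw [voronoiCoverage, PointPattern.lintegral_pointKernel] at h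
  have h2 := (ENNReal.sum_le_tsum (f := fun z : η.points => voronoiIndicator ((η, (z : S)), u))
    {⟨x, hx⟩, ⟨y, hy⟩}).trans h
  rw [Finset.sum_pair (by simpa using hne), voronoiIndicator_of_mem hux,
    voronoiIndicator_of_mem huy] at h2
  norm_num at h2

theorem exists_ne_of_one_lt_voronoiCoverage {η : PointPattern S} {u : S}
    (h : 1 < voronoiCoverage (η, u)) : ∃ x ∈ η.points, ∃ y ∈ η.points, x ≠ y ∧
      u ∈ voronoiCell Set.univ η x ∧ u ∈ voronoiCell Set.univ η y := by
  by_contra! hcon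
  rw [voronoiCoverage, PointPattern.lintegral_pointKernel] at h
  refine h.not_ge ?_
  by_cases hx : ∃ x ∈ η.points, u ∈ voronoiCell Set.univ η x
  · obtain ⟨x, hx, hux⟩ := hx
    rw [tsum_eq_single (⟨x, hx⟩ : η.points), voronoiIndicator_of_mem hux]
    exact fun y hy => voronoiIndicator_of_notMem
      (hcon x hx y y.2 (fun h => hy (Subtype.ext h.symm)) hux)
  · push Not at hx
    rw [ENNReal.tsum_eq_zero.2]
    · exact zero_le_one
    · exact fun y => voronoiIndicator_of_notMem (hx y y.2)

theorem measure_one_lt_voronoiCoverage_eq_zero {μ : Measure S} {η : PointPattern S}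
    (h : VoronoiNullOverlap μ Set.univ η) : μ {u | 1 < voronoiCoverage (η, u)} = 0 := by
  refine measure_mono_null (t := ⋃ x ∈ η.points, ⋃ y ∈ η.points \ {x},
    voronoiCell Set.univ η x ∩ voronoiCell Set.univ η y) ?_ ?_
  · intro u hu
    obtain ⟨x, hx, y, hy, hne, hux, huy⟩ := exists_ne_of_one_lt_voronoiCoverage hu
    simp only [Set.mem_iUnion]
    exact ⟨x, hx, y, ⟨hy, hne.symm⟩, hux, huy⟩
  · rw [measure_biUnion_null_iff η.countable_points]
    intro x hx
    rw [measure_biUnion_null_iff (η.countable_points.mono Set.sdiff_subset)]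
    exact fun y hy => h x ⟨hx, trivial⟩ y ⟨hy.1, trivial⟩ (Ne.symm hy.2)

/-- Where at most one cell covers `u`, the tie rule has no choice. The estimator thus agrees with a
measurable function although `τ` may be non-measurable. -/
theorem voronoiEstimator_eq_toReal_voronoiWeightSum {μ : Measure S} {η : PointPattern S} {u : S}
    {τ : PointPattern S → S → S} (hτ : IsTieRule Set.univ τ) (h : voronoiCoverage (η, u) ≤ 1) :
    voronoiEstimator μ Set.univ τ η u = (voronoiWeightSum μ (η, u)).toReal := by
  classical
  rw [voronoiWeightSum, PointPattern.lintegral_pointKernel]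
  unfold voronoiEstimator
  by_cases hx : ∃ x ∈ η.points, u ∈ voronoiCell Set.univ η x
  · obtain ⟨x, hx, hux⟩ := hx
    obtain ⟨hτη, hτu⟩ := hτ η u ⟨x, ⟨hx, trivial⟩, hux⟩
    have hτx : τ η u = x := eq_of_voronoiCoverage_le_one h hτη.1 hx hτu hux
    rw [tsum_eq_single (⟨x, hx, trivial⟩ : ↥(η.points ∩ Set.univ)),
      tsum_eq_single (⟨x, hx⟩ : η.points), if_pos ⟨hux, hτx⟩, voronoiWeight,
      voronoiIndicator_of_mem hux, one_mul]
    · intro y hy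
      rw [voronoiWeight, voronoiIndicator_of_notMem, zero_mul]
      exact fun huy => hy (Subtype.ext (eq_of_voronoiCoverage_le_one h y.2 hx huy hux))
    · intro y hy
      rw [if_neg]
      exact fun huy => hy (Subtype.ext (huy.2.symm.trans hτx))
  · push Not at hx
    rw [ENNReal.tsum_eq_zero.2]
    · convert! tsum_zero with y
      rw [if_neg]
      exact fun huy => hx y y.2.1 huy.1
    · intro y
      rw [voronoiWeight, voronoiIndicator_of_notMem (hx y y.2), zero_mul]

section Invariance

variable {G : Type*} [Group G] [MulAction G S] [IsIsometricSMul G S]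

theorem voronoiIndicator_shift (g : G) (η : PointPattern S) (x u : S) :
    voronoiIndicator ((η.shift g, g • x), g • u) = voronoiIndicator ((η, x), u) := by
  by_cases h : u ∈ voronoiCell Set.univ η x
  · rw [voronoiIndicator_of_mem h,
      voronoiIndicator_of_mem ((smul_mem_voronoiCell_shift_iff g η x u).2 h)]
  · rw [voronoiIndicator_of_notMem h,
      voronoiIndicator_of_notMem ((smul_mem_voronoiCell_shift_iff g η x u).not.2 h)]

theorem voronoiCoverage_shift (g : G) (η : PointPattern S) (u : S) :
    voronoiCoverage (η.shift g, g • u) = voronoiCoverage (η, u) := by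
  simp only [voronoiCoverage]
  rw [PointPattern.lintegral_pointKernel_shift]
  simp_rw [voronoiIndicator_shift]

theorem measure_voronoiCell_shift (μ : Measure S) [SMulInvariantMeasure G S μ] (g : G)
    (η : PointPattern S) (x : S) :
    μ (voronoiCell Set.univ (η.shift g) (g • x)) = μ (voronoiCell Set.univ η x) := by
  rw [← measure_preimage_smul μ g]
  congr 1
  ext u
  exact smul_mem_voronoiCell_shift_iff g η x u

theorem voronoiWeight_shift (μ : Measure S) [SMulInvariantMeasure G S μ] (g : G)
    (η : PointPattern S) (x u : S) :
    voronoiWeight μ ((η.shift g, g • x), g • u) = voronoiWeight μ ((η, x), u) := by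
  simp only [voronoiWeight]
  rw [voronoiIndicator_shift, measure_voronoiCell_shift]

theorem voronoiWeightSum_shift (μ : Measure S) [SMulInvariantMeasure G S μ] (g : G)
    (η : PointPattern S) (u : S) :
    voronoiWeightSum μ (η.shift g, g • u) = voronoiWeightSum μ (η, u) := by
  simp only [voronoiWeightSum]
  rw [PointPattern.lintegral_pointKernel_shift]
  simp_rw [voronoiWeight_shift]

end Invariance

end VoronoiMeasurability

/-! ### Transport for stationary laws and unbiasedness -/

section StationaryLaw

open PointPattern

variable {S G : Type*} [MetricSpace S] [MeasurableSpace S] [BorelSpace S]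
  [SecondCountableTopology S] [Group G] [MulAction G S] [IsIsometricSMul G S]

theorem lintegral_smul_of_invariant (μ : Measure S) [SMulInvariantMeasure G S μ] (g : G)
    {f : S → ℝ≥0∞} (hf : Measurable f) : ∫⁻ u, f (g • u) ∂μ = ∫⁻ u, f u ∂μ := by
  have hg : Measurable fun u : S => g • u := (isometry_smul S g).continuous.measurable
  have hmp : MeasurePreserving (fun u : S => g • u) μ μ :=
    ⟨hg, Measure.ext fun s hs => by rw [Measure.map_apply hg hs, measure_preimage_smul]⟩
  exact hmp.lintegral_comp hf

theorem lintegral_eq_of_shift_invariant [MulAction.IsPretransitive G S]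
    {Q : Measure (PointPattern S)}
    (hQ : ∀ g : G, Q.map (fun η => η.shift g) = Q) {h : PointPattern S × S → ℝ≥0∞}
    (hm : Measurable h) (hh : ∀ (g : G) η u, h (η.shift g, g • u) = h (η, u)) (u v : S) :
    ∫⁻ η, h (η, u) ∂Q = ∫⁻ η, h (η, v) ∂Q := by
  obtain ⟨g, rfl⟩ := MulAction.exists_smul_eq G u v
  have h1 : ∫⁻ η, h (η, g • u) ∂Q.map (fun η => η.shift g) = ∫⁻ η, h (η.shift g, g • u) ∂Q :=
    lintegral_map (hm.comp measurable_prodMk_right) (measurable_shift g)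
  rw [hQ] at h1
  simp_rw [h1, hh]

theorem lintegral_campbell_shift {Q : Measure (PointPattern S)}
    (μ : Measure S) [SFinite μ] [SMulInvariantMeasure G S μ] (g : G)
    (hQ : Q.map (fun η => η.shift g) = Q) {F : (PointPattern S × S) × S → ℝ≥0∞}
    (hF : Measurable F) :
    ∫⁻ η : PointPattern S, ∫⁻ x, ∫⁻ u, F ((η.shift g, g • x), g • u) ∂μ ∂pointKernel S η ∂Q =
      ∫⁻ η, ∫⁻ x, ∫⁻ u, F ((η, x), u) ∂μ ∂pointKernel S η ∂Q := by
  have h1 : ∀ (η : PointPattern S) x, ∫⁻ u, F ((η.shift g, g • x), g • u) ∂μ =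
      ∫⁻ u, F ((η.shift g, g • x), u) ∂μ := fun η x =>
    lintegral_smul_of_invariant μ g (f := fun u => F ((η.shift g, g • x), u))
      (hF.comp measurable_prodMk_left)
  have h2 : ∀ η : PointPattern S,
      ∫⁻ x, ∫⁻ u, F ((η.shift g, g • x), u) ∂μ ∂pointKernel S η =
        ∫⁻ x, ∫⁻ u, F ((η.shift g, x), u) ∂μ ∂pointKernel S (η.shift g) := fun η =>
    (lintegral_pointKernel_shift g η fun x => ∫⁻ u, F ((η.shift g, x), u) ∂μ).symm
  simp_rw [h1, h2]
  have hm : Measurable fun η : PointPattern S =>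
      ∫⁻ x, ∫⁻ u, F ((η, x), u) ∂μ ∂pointKernel S η :=
    hF.lintegral_prod_right'.lintegral_kernel_prod_right'
  rw [← lintegral_map hm (measurable_shift g), hQ]

/-- The mass transport principle for a stationary point process. -/
theorem lintegral_mass_transport [TopologicalSpace G] [IsTopologicalGroup G]
    [LocallyCompactSpace G] [SecondCountableTopology G] [MeasurableSpace G] [BorelSpace G]
    [ContinuousSMul G S] [MulAction.IsPretransitive G S]
    (ν : Measure G) [ν.IsHaarMeasure] [ν.IsMulRightInvariant]
    (μ : Measure S) [SFinite μ] [SMulInvariantMeasure G S μ]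
    {Q : Measure (PointPattern S)} [SFinite Q]
    (hQ : ∀ g : G, Q.map (fun η => η.shift g) = Q) {φ : (PointPattern S × S) × S → ℝ≥0∞}
    (hφ : Measurable φ) (hφG : ∀ (g : G) η x u, φ ((η.shift g, g • x), g • u) = φ ((η, x), u))
    (o : S) {r : ℝ} (hr : 0 < r) (hfin : ν {g : G | g • o ∈ Metric.ball o r} < ∞) :
    ∫⁻ η, ∫⁻ x, ∫⁻ u, φ ((η, x), u) * (Metric.ball o r).indicator 1 x ∂μ ∂pointKernel S η ∂Q =
      ∫⁻ η, ∫⁻ x, ∫⁻ u, φ ((η, x), u) * (Metric.ball o r).indicator 1 u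
        ∂μ ∂pointKernel S η ∂Q := by
  have hpr : Measurable fun q : (PointPattern S × S) × S => (q.1.2, q.2) :=
    (measurable_snd.comp measurable_fst).prodMk measurable_snd
  -- Expected mass sent from the first coordinate to the second. Its diagonal invariance combines
  -- the invariance of `Q`, `μ` and `φ`.
  let M : Measure (S × S) :=
    (((Q ⊗ₘ pointKernel S).prod μ).withDensity φ).map fun q => (q.1.2, q.2)
  have hMint : ∀ f : S × S → ℝ≥0∞, Measurable f → ∫⁻ z, f z ∂M =
      ∫⁻ η, ∫⁻ x, ∫⁻ u, φ ((η, x), u) * f (x, u) ∂μ ∂pointKernel S η ∂Q := by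
    intro f hf
    have hm : Measurable fun q : (PointPattern S × S) × S => φ q * f (q.1.2, q.2) :=
      hφ.mul (hf.comp hpr)
    have hfpr : Measurable fun q : (PointPattern S × S) × S => f (q.1.2, q.2) := hf.comp hpr
    rw [lintegral_map hf hpr, lintegral_withDensity_eq_lintegral_mul _ hφ hfpr]
    change ∫⁻ q, φ q * f (q.1.2, q.2) ∂_ = _
    rw [lintegral_prod _ hm.aemeasurable, Measure.lintegral_compProd hm.lintegral_prod_right']
  have hM : ∀ (g : G) (f : S × S → ℝ≥0∞), Measurable f →
      ∫⁻ z, f (g • z.1, g • z.2) ∂M = ∫⁻ z, f z ∂M := by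
    intro g f hf
    have hg : Measurable fun u : S => g • u := (isometry_smul S g).continuous.measurable
    have hfg : Measurable fun z : S × S => f (g • z.1, g • z.2) :=
      hf.comp ((hg.comp measurable_fst).prodMk (hg.comp measurable_snd))
    rw [hMint f hf, hMint _ hfg, ← lintegral_campbell_shift μ g (hQ g) (F := fun q => φ q * f (q.1.2, q.2))
        (hφ.mul (hf.comp hpr))]
    simp_rw [hφG]
  have hI : Measurable ((Metric.ball o r).indicator (1 : S → ℝ≥0∞)) :=
    measurable_one.indicator measurableSet_ball
  have key := mass_transport_ball ν M hM o hr hfin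
  rw [← lintegral_indicator_one (measurable_fst measurableSet_ball),
    ← lintegral_indicator_one (measurable_snd measurableSet_ball)] at key
  exact (hMint _ (hI.comp measurable_fst)).symm.trans (key.trans (hMint _ (hI.comp measurable_snd)))

/-- By Fubini the probability of multiple coverage at `v` has zero `μ`-integral. It does not depend
on `v`, so it vanishes at every location, not merely almost everywhere. -/
theorem ae_voronoiCoverage_le_one [MulAction.IsPretransitive G S]
    {μ : Measure S} [SFinite μ] (hμ : μ ≠ 0)
    {Q : Measure (PointPattern S)} [SFinite Q] (hQ : ∀ g : G, Q.map (fun η => η.shift g) = Q)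
    (hover : ∀ᵐ η ∂Q, μ {u | 1 < voronoiCoverage (η, u)} = 0) (u : S) :
    ∀ᵐ η ∂Q, voronoiCoverage (η, u) ≤ 1 := by
  let O : Set (PointPattern S × S) := {q | 1 < voronoiCoverage q}
  have hO : MeasurableSet O := measurableSet_lt measurable_const measurable_voronoiCoverage
  have hOm : Measurable (O.indicator (1 : PointPattern S × S → ℝ≥0∞)) := measurable_one.indicator hO
  have hOinv : ∀ (g : G) η u, O.indicator (1 : PointPattern S × S → ℝ≥0∞) (η.shift g, g • u) =
      O.indicator 1 (η, u) := by
    intro g η u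
    simp only [Set.indicator_apply, O, Set.mem_ofPred_eq, voronoiCoverage_shift, Pi.one_apply]
  have hzero : ∫⁻ v, ∫⁻ η, O.indicator (1 : PointPattern S × S → ℝ≥0∞) (η, v) ∂Q ∂μ = 0 := by
    have hsw : Measurable (Function.uncurry fun v η =>
        O.indicator (1 : PointPattern S × S → ℝ≥0∞) (η, v)) := hOm.comp measurable_swap
    rw [lintegral_lintegral_swap hsw.aemeasurable]
    refine (lintegral_congr_ae (g := fun _ => 0) ?_).trans lintegral_zero
    filter_upwards [hover] with η hη
    rw [← hη]
    exact lintegral_indicator_one (measurable_prodMk_left hO)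
  simp_rw [fun v => lintegral_eq_of_shift_invariant hQ hOm hOinv v u, lintegral_const] at hzero
  have hu : ∫⁻ η, O.indicator (1 : PointPattern S × S → ℝ≥0∞) (η, u) ∂Q = 0 := by
    rcases mul_eq_zero.1 hzero with h | h
    · exact h
    · exact absurd (Measure.measure_univ_eq_zero.1 h) hμ
  have hQO : Q {η | 1 < voronoiCoverage (η, u)} = 0 := by
    rw [← hu]
    exact (lintegral_indicator_one (measurable_prodMk_right hO)).symm
  rw [ae_iff]
  simpa using hQO

/-- Unbiasedness of the Voronoi estimator for a stationary law. -/
theorem lintegral_voronoiWeightSum [CompleteSpace S] [TopologicalSpace G] [IsTopologicalGroup G]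
    [LocallyCompactSpace G] [SecondCountableTopology G] [MeasurableSpace G] [BorelSpace G]
    [ContinuousSMul G S] [MulAction.IsPretransitive G S]
    (hG : IsUnimodularGroup G)
    (hstab : ∀ s : S, IsCompact (MulAction.stabilizer G s : Set G))
    (μ : Measure S) [IsLocallyFiniteMeasure μ] [SMulInvariantMeasure G S μ] (hμ : μ ≠ 0)
    {Q : Measure (PointPattern S)} [SFinite Q]
    (hQ : ∀ g : G, Q.map (fun η => η.shift g) = Q)
    (hover : ∀ u, ∀ᵐ η ∂Q, voronoiCoverage (η, u) ≤ 1) (hQ1 : Q Set.univ ≤ 1)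
    {c : ℝ≥0∞} (hc : ∀ A : Set S, MeasurableSet A →
      ∫⁻ η, ((η.points ∩ A).encard : ℝ≥0∞) ∂Q = c * μ A) (u : S) :
    ∫⁻ η, voronoiWeightSum μ (η, u) ∂Q = c := by
  let ν : Measure G := Measure.haar
  have : ν.IsMulRightInvariant := hG ν inferInstance
  obtain ⟨r, hνr, hμr, hr⟩ : ∃ r : ℝ, ν {g : G | g • u ∈ Metric.ball u r} < ∞ ∧
      μ (Metric.ball u r) < ∞ ∧ 0 < r := by
    obtain ⟨s, hs, hμs⟩ := μ.finiteAt_nhds u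
    obtain ⟨ε, hε, hball⟩ := Metric.mem_nhds_iff.1 hs
    refine ((eventually_haar_smul_mem_ball_lt_top u (hstab u) ν).and ?_).exists
    filter_upwards [Ioo_mem_nhdsGT hε] with r hr
    exact ⟨(measure_mono ((Metric.ball_subset_ball hr.2.le).trans hball)).trans_lt hμs, hr.1⟩
  set A := Metric.ball u r
  have hA : MeasurableSet A := measurableSet_ball
  have hμ0 : μ A ≠ 0 := (measure_ball_pos_of_isPretransitive (G := G) μ hμ u hr).ne'
  have hI : Measurable (A.indicator (1 : S → ℝ≥0∞)) := measurable_one.indicator hA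
  have hIv : ∀ t : ℝ≥0∞, ∀ x, A.indicator (1 : S → ℝ≥0∞) x ≠ 0 →
      t * A.indicator (1 : S → ℝ≥0∞) x = t := by
    intro t x hx
    have : x ∈ A := by by_contra h; simp [h] at hx
    simp [this]
  have hincoming : ∀ φ : (PointPattern S × S) × S → ℝ≥0∞, Measurable φ →
      ∫⁻ η, ∫⁻ x, ∫⁻ v, φ ((η, x), v) * A.indicator 1 v ∂μ ∂pointKernel S η ∂Q =
        ∫⁻ v, (∫⁻ η, ∫⁻ x, φ ((η, x), v) ∂pointKernel S η ∂Q) * A.indicator 1 v ∂μ := by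
    intro φ hφ
    have h1 : ∀ η : PointPattern S,
        ∫⁻ x, ∫⁻ v, φ ((η, x), v) * A.indicator 1 v ∂μ ∂pointKernel S η =
          ∫⁻ v, (∫⁻ x, φ ((η, x), v) ∂pointKernel S η) * A.indicator 1 v ∂μ := by
      intro η
      rw [lintegral_lintegral_swap]
      · refine lintegral_congr fun v => lintegral_mul_const _ ?_
        exact hφ.comp (measurable_prodMk_left.prodMk measurable_const)
      · exact ((hφ.comp ((measurable_const.prodMk measurable_fst).prodMk measurable_snd)).mul
          (hI.comp measurable_snd)).aemeasurable
    have hm := measurable_lintegral_pointKernel hφ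
    simp_rw [h1]
    rw [lintegral_lintegral_swap (hm.mul (hI.comp measurable_snd)).aemeasurable]
    exact lintegral_congr fun v => lintegral_mul_const _ (hm.comp measurable_prodMk_right)
  have hindm : ∀ (η : PointPattern S) x, Measurable fun v => voronoiIndicator ((η, x), v) :=
    fun η x => measurable_voronoiIndicator.comp measurable_prodMk_left
  have hwm : ∀ (η : PointPattern S) x, Measurable fun v => voronoiWeight μ ((η, x), v) :=
    fun η x => (measurable_voronoiWeight μ).comp measurable_prodMk_left
  have hcellm := measurable_measure_voronoiCell μ
  -- Transport with the cell indicator: a point sends out the measure of its cell, and a location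
  -- receives its coverage, at most 1 almost surely. Hence the total is at most `μ A`.
  have hmass : ∫⁻ η, ∫⁻ x, μ (voronoiCell Set.univ η x) * A.indicator 1 x ∂pointKernel S η ∂Q
      < ∞ := by
    have h := lintegral_mass_transport ν μ hQ measurable_voronoiIndicator
      (fun g η x v => voronoiIndicator_shift g η x v) u hr hνr
    rw [hincoming _ measurable_voronoiIndicator] at h
    have hl : ∀ (η : PointPattern S) x,
        ∫⁻ v, voronoiIndicator ((η, x), v) * A.indicator 1 x ∂μ =
          μ (voronoiCell Set.univ η x) * A.indicator 1 x := fun η x => by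
      rw [lintegral_mul_const _ (hindm η x),
        lintegral_voronoiIndicator]
    rw [show Metric.ball u r = A from rfl] at h
    simp_rw [hl] at h
    rw [h]
    refine lt_of_le_of_lt (lintegral_mono (g := A.indicator 1) fun v => ?_) ?_
    · refine mul_le_of_le_one_left zero_le ?_
      calc ∫⁻ η, voronoiCoverage (η, v) ∂Q ≤ ∫⁻ _, 1 ∂Q := lintegral_mono_ae (hover v)
        _ ≤ 1 := by rwa [lintegral_one]
    · rw [lintegral_indicator_one hA]
      exact hμr
  have hcellfin : ∀ᵐ η ∂Q, ∀ x ∈ η.points,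
      μ (voronoiCell Set.univ η x) * A.indicator 1 x < ∞ := by
    have hm : Measurable fun q : PointPattern S × S =>
        μ (voronoiCell Set.univ q.1 q.2) * A.indicator 1 q.2 :=
      hcellm.mul (hI.comp measurable_snd)
    filter_upwards [ae_lt_top hm.lintegral_kernel_prod_right' hmass.ne] with η hη
    rw [← ae_pointKernel_iff η fun x => μ (voronoiCell Set.univ η x) * A.indicator 1 x < ∞]
    exact ae_lt_top (hm.comp measurable_prodMk_left) hη.ne
  -- Points of `A` have cells of positive finite measure, so each sends out exactly 1 and the total
  -- is the expected number of points in `A`.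
  have houtgoing : ∫⁻ η, ∫⁻ x, ∫⁻ v, voronoiWeight μ ((η, x), v) * A.indicator 1 x
      ∂μ ∂pointKernel S η ∂Q = c * μ A := by
    rw [← hc A hA]
    refine lintegral_congr_ae ?_
    filter_upwards [hcellfin] with η hη
    rw [← pointKernel_apply η hA, ← lintegral_indicator_one hA]
    refine lintegral_congr_ae ((ae_pointKernel_iff η _).2 fun x hx => ?_)
    have hpos : μ (voronoiCell Set.univ η x) ≠ 0 := by
      obtain ⟨s, hs, hball⟩ := exists_ball_subset_voronoiCell η x
      exact ((measure_ball_pos_of_isPretransitive (G := G) μ hμ x hs).trans_le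
        (measure_mono hball)).ne'
    simp only
    rw [lintegral_mul_const _ (hwm η x)]
    by_cases h0 : A.indicator (1 : S → ℝ≥0∞) x = 0
    · rw [h0, mul_zero]
    have hfin := hη x hx
    rw [hIv _ x h0] at hfin
    have : ∫⁻ v, voronoiWeight μ ((η, x), v) ∂μ = 1 := by
      simp only [voronoiWeight]
      rw [lintegral_mul_const _ (hindm η x),
        lintegral_voronoiIndicator, ENNReal.mul_inv_cancel hpos hfin.ne]
    rw [this, one_mul]
  have h := lintegral_mass_transport ν μ hQ (measurable_voronoiWeight μ)
    (fun g η x v => voronoiWeight_shift μ g η x v) u hr hνr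
  rw [houtgoing, hincoming _ (measurable_voronoiWeight μ)] at h
  have hconst : ∀ v, ∫⁻ η, ∫⁻ x, voronoiWeight μ ((η, x), v) ∂pointKernel S η ∂Q =
      ∫⁻ η, voronoiWeightSum μ (η, u) ∂Q := fun v =>
    lintegral_eq_of_shift_invariant hQ (measurable_voronoiWeightSum μ)
      (voronoiWeightSum_shift μ) v u
  simp_rw [hconst] at h
  rw [lintegral_const_mul _ hI, lintegral_indicator_one hA] at h
  exact ((ENNReal.mul_left_inj hμ0 hμr.ne).1 h).symm

end StationaryLaw

/-! ### Application to the thinnings -/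

/-- The stationary result is applied to the law of the measurable modification `Z`, with intensity
`p * ρ`; the estimator of `Y i` is then recovered almost surely. -/
theorem integral_voronoiEstimator_thinning
    {Ω S G : Type*} [MetricSpace S] [CompleteSpace S] [SecondCountableTopology S]
    [MeasurableSpace S] [BorelSpace S]
    [Group G] [TopologicalSpace G] [IsTopologicalGroup G]
    [LocallyCompactSpace G] [SecondCountableTopology G] [MeasurableSpace G] [BorelSpace G]
    (hG : IsUnimodularGroup G)
    [MulAction G S] [ContinuousSMul G S] [IsIsometricSMul G S] [MulAction.IsPretransitive G S]
    (hstab : ∀ s : S, IsCompact (MulAction.stabilizer G s : Set G))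
    (μ : Measure S) [IsLocallyFiniteMeasure μ] [SMulInvariantMeasure G S μ] (hμ : μ ≠ 0)
    [MeasurableSpace Ω] (P : Measure Ω) [IsProbabilityMeasure P]
    {X : Ω → PointPattern S} (hstat : IsStationaryProcess G P X)
    {ρ : ℝ≥0} (hint : HasIntensity P μ X (fun _ => ρ))
    {p : ℝ} (hp0 : 0 < p) {m : ℕ}
    {Y : Fin m → Ω → PointPattern S} (hY : IsThinning P X p Y) (i : Fin m)
    (htess : ∀ᵐ ω ∂P, VoronoiNullOverlap μ Set.univ (Y i ω))
    {τ : PointPattern S → S → S} (hτ : IsTieRule Set.univ τ) (u : S) :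
    Integrable (fun ω => voronoiEstimator μ Set.univ τ (Y i ω) u) P ∧
      ∫ ω, voronoiEstimator μ Set.univ τ (Y i ω) u ∂P = p * ρ := by
  obtain ⟨N, ξ, B, hN, hξ, hB, hX, hBp, hind, hindep, hYi⟩ := hY
  have hindep' : IndepFun (fun ω => (N ω, fun n => ξ n ω)) (fun ω n => B (i, n) ω) P :=
    hindep.comp measurable_id
      (measurable_pi_lambda _ fun n => measurable_pi_apply (X := fun _ : Fin m × ℕ => Bool) (i, n))
  obtain ⟨Z, hZm, hZY, hvoid, hcount⟩ := exists_measurable_modification_thinning P hN hξ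
    (fun n => hB (i, n)) hX (fun n => hBp (i, n))
    (hind.precomp (g := fun n : ℕ => (i, n)) fun a b h => (Prod.mk.inj h).2) hindep' (hYi i)
  have hQprob : IsProbabilityMeasure (P.map Z) := Measure.isProbabilityMeasure_map hZm.aemeasurable
  have hQ := map_shift_of_void_eq P hstat hZm (fun k => (1 - ENNReal.ofReal p) ^ k.toNat) hvoid
  have hcovm := measurable_voronoiCoverage (S := S)
  have hover : ∀ᵐ η ∂P.map Z, μ {v | 1 < voronoiCoverage (η, v)} = 0 := by
    have hO : MeasurableSet {q : PointPattern S × S | 1 < voronoiCoverage q} :=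
      measurableSet_lt measurable_const hcovm
    have hO' : MeasurableSet {η : PointPattern S | μ {v | 1 < voronoiCoverage (η, v)} = 0} :=
      (measurable_measure_prodMk_left (ν := μ) hO) (measurableSet_singleton 0)
    rw [ae_map_iff hZm.aemeasurable hO']
    filter_upwards [htess, hZY] with ω hω hωZ
    rw [hωZ]
    exact measure_one_lt_voronoiCoverage_eq_zero hω
  have hcov := ae_voronoiCoverage_le_one hμ hQ hover
  have hintens : ∀ A : Set S, MeasurableSet A →
      ∫⁻ η, ((η.points ∩ A).encard : ℝ≥0∞) ∂P.map Z = ENNReal.ofReal p * ρ * μ A := by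
    intro A hA
    have hAm : Measurable fun η : PointPattern S => ((η.points ∩ A).encard : ℝ≥0∞) :=
      (measurable_from_top (f := ENat.toENNReal)).comp (PointPattern.measurable_encard_inter hA)
    rw [lintegral_map hAm hZm, hcount A hA, mul_assoc]
    congr 1
    have h := hint.2 (A.indicator 1) (measurable_one.indicator hA)
    simp_rw [← PointPattern.lintegral_pointKernel, lintegral_indicator_one hA,
      PointPattern.pointKernel_apply _ hA] at h
    rw [h, lintegral_mul_const _ (measurable_one.indicator hA), lintegral_indicator_one hA,
      mul_comm]
  have hlint := lintegral_voronoiWeightSum hG hstab μ hμ hQ hcov prob_le_one hintens u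
  have hWm : Measurable fun η : PointPattern S => voronoiWeightSum μ (η, u) :=
    (measurable_voronoiWeightSum μ).comp measurable_prodMk_right
  rw [lintegral_map hWm hZm] at hlint
  have hne : ∫⁻ ω, voronoiWeightSum μ (Z ω, u) ∂P ≠ ∞ := by
    rw [hlint]
    exact ENNReal.mul_ne_top ENNReal.ofReal_ne_top ENNReal.coe_ne_top
  have hWZ := hWm.comp hZm
  have heq : (fun ω => voronoiEstimator μ Set.univ τ (Y i ω) u) =ᵐ[P]
      fun ω => (voronoiWeightSum μ (Z ω, u)).toReal := by
    filter_upwards [hZY, ae_of_ae_map hZm.aemeasurable (hcov u)] with ω hω hωc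
    rw [← voronoiEstimator_eq_toReal_voronoiWeightSum hτ hωc, hω]
  refine ⟨(integrable_toReal_of_lintegral_ne_top hWZ.aemeasurable hne).congr heq.symm, ?_⟩
  rw [integral_congr_ae heq]
  refine (integral_toReal hWZ.aemeasurable (ae_lt_top hWZ hne)).trans ?_
  rw [Function.comp_def, hlint, ENNReal.toReal_mul, ENNReal.toReal_ofReal hp0.le,
    ENNReal.coe_toReal]

theorem theorem1
    {Ω S G : Type*}
    [MetricSpace S] [CompleteSpace S] [TopologicalSpace.SeparableSpace S]
    [MeasurableSpace S] [BorelSpace S]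
    [Group G] [TopologicalSpace G] [IsTopologicalGroup G] [T2Space G]
    [LocallyCompactSpace G] [SecondCountableTopology G] [MeasurableSpace G] [BorelSpace G]
    (hG : IsUnimodularGroup G)
    [MulAction G S] [ContinuousSMul G S] [IsIsometricSMul G S] [MulAction.IsPretransitive G S]
    (hstab : ∀ s : S, IsCompact (MulAction.stabilizer G s : Set G))
    (μ : Measure S) [IsLocallyFiniteMeasure μ] [SMulInvariantMeasure G S μ] (hμ : μ ≠ 0)
    [MeasurableSpace Ω] (P : Measure Ω) [IsProbabilityMeasure P]
    (X : Ω → PointPattern S) (hX : IsPointProcess X) (hstat : IsStationaryProcess G P X)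
    (ρ : ℝ≥0) (hρ : 0 < ρ) (hint : HasIntensity P μ X (fun _ => ρ))
    (p : ℝ) (hp0 : 0 < p) (hp1 : p ≤ 1) (m : ℕ) (hm : 1 ≤ m)
    (Y : Fin m → Ω → PointPattern S) (hY : IsThinning P X p Y)
    (htess : ∀ i, ∀ᵐ ω ∂P, VoronoiNullOverlap μ Set.univ (Y i ω))
    (τ : PointPattern S → S → S) (hτ : IsTieRule Set.univ τ)
    (u : S) :
    Integrable (fun ω => resampleSmoothedVoronoi μ Set.univ τ p (fun i => Y i ω) u) P ∧
      ∫ ω, resampleSmoothedVoronoi μ Set.univ τ p (fun i => Y i ω) u ∂P = ρ := by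
  have : SecondCountableTopology S := UniformSpace.secondCountable_of_separable S
  have key := fun i => integral_voronoiEstimator_thinning hG hstab μ hμ P hstat hint hp0 hY i
    (htess i) hτ u
  have hI : Integrable (fun ω => ∑ i, voronoiEstimator μ Set.univ τ (Y i ω) u / p) P :=
    integrable_finsetSum _ fun i _ => (key i).1.div_const p
  refine ⟨hI.const_mul _, ?_⟩
  simp only [resampleSmoothedVoronoi]
  rw [integral_const_mul, integral_finsetSum _ fun i _ => (key i).1.div_const p]
  simp_rw [integral_div, (key _).2]
  have hm0 : (m : ℝ) ≠ 0 := by positivity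
  rw [Finset.sum_const, Finset.card_univ, Fintype.card_fin, nsmul_eq_mul]
  field_simp
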